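/- A contracting similarity of $\mathbb{R}^n$ is a map $S(x)=r\,T(x)+v$ with $0<r<1$, $T$ an orthogonal transformation and $v\in\mathbb{R}^n$. Let $S_i(x)=r_iT_i(x)+v_i$ ($1\le i\le m$) be contracting similarities of $\mathbb{R}^d$, and let $K\subseteq\mathbb{R}^d$ be the attractor of $\{S_i\}_{i=1}^m$, i.e. the unique nonempty compact set with $K=\bigcup_{i=1}^m S_i(K)$; assume that $K$ contains at least two points. Let $s$ be the similarity dimension of $\{S_i\}_{i=1}^m$, i.e. the unique real solution of $\sum_{i=1}^m r_i^s=1$. Let $\mathcal{T}$ be the group generated by $T_1,\dots,T_m$, and assume that $\mathcal{T}=\{O_1,\dots,O_q\}$ is finite, where $q=|\mathcal{T}|$. Let $L:\mathbb{R}^d\to\mathbb{R}^{d_2}$ be a linear map. Then there exist a finite directed graph (parallel edges and loops allowed) with vertex set $\{1,\dots,q\}$ and, for each edge $e$, a contracting similarity $S_e(x)=r_eT_e(x)+v_e$ of $\mathbb{R}^{d_2}$, such that, writing $\mathcal{E}_{i,j}$ for the set of edges from $i$ to $j$: 1. every vertex has an outgoing edge, and the graph is strongly connected: for all vertices $i,j$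 there is a directed path with at least one edge from $i$ to $j$; 2. $(L\circ O_1(K),\dots,L\circ O_q(K))$ is the attractor of this graph-directed iterated function system, i.e. each $K_i:=L\circ O_i(K)$ is nonempty and compact, and $K_i=\bigcup_{j=1}^q\bigcup_{e\in\mathcal{E}_{i,j}}S_e(K_j)$ for every $i$; 3. $T_e$ is the identity for every edge $e$, so that $S_e(x)=r_ex+v_e$; 4. $s$ is the similarity dimension of the graph-directed iterated function system, i.e. $s$ is the unique real number for which the $q\times q$ matrix $A^{(s)}$ with entries $A^{(s)}_{i,j}=\sum_{e\in\mathcal{E}_{i,j}}r_e^s$ has spectral radius $\rho(A^{(s)})=1$. Moreover, with $\mathcal{H}^s$ denoting $s$-dimensional Hausdorff measure, $\mathcal{H}^s(L\circ O_1(K))=\dots=\mathcal{H}^s(L\circ O_q(K))$. -/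

import Mathlib

noncomputable section

namespace SelfSimilar

/-- The Euclidean space `ℝ^d` (with its Euclidean norm). -/
abbrev Euc (d : ℕ) : Type := EuclideanSpace ℝ (Fin d)

/-- A contracting similarity `x ↦ r T(x) + v` of `ℝ^d`: contraction ratio `0 < r < 1`,
orthogonal transformation `T`, translation vector `v`. -/
structure ContractingSimilarity (d : ℕ) where
  ratio : ℝ
  orth : Euc d ≃ₗᵢ[ℝ] Euc d
  trans : Euc d
  ratio_pos : 0 < ratio
  ratio_lt_one : ratio < 1

/-- The underlying map `x ↦ r T(x) + v`. -/
def ContractingSimilarity.map {d : ℕ} (S : ContractingSimilarity d) (x : Euc d) : Euc d :=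
  S.ratio • S.orth x + S.trans

/-- The map of a contracting similarity multiplies all distances by the contraction ratio. -/
theorem ContractingSimilarity.dist_map {d : ℕ} (S : ContractingSimilarity d) (x y : Euc d) :
    dist (S.map x) (S.map y) = S.ratio * dist x y := by
  simp [ContractingSimilarity.map, dist_smul₀, abs_of_pos S.ratio_pos]

/-- Every self-map of `ℝ^d` that multiplies all distances by some `r` with `0 < r < 1` is the map
of a contracting similarity in the sense above. -/
theorem ContractingSimilarity.exists_of_dist {d : ℕ} {f : Euc d → Euc d} {r : ℝ}
    (h0 : 0 < r) (h1 : r < 1) (hf : ∀ x y, dist (f x) (f y) = r * dist x y) :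
    ∃ S : ContractingSimilarity d, S.ratio = r ∧ S.map = f := by
  have hg : Isometry (fun x => r⁻¹ • f x) := by
    refine Isometry.of_dist_eq fun x y => ?_
    rw [dist_smul₀, hf, Real.norm_eq_abs, abs_of_pos (inv_pos.2 h0), inv_mul_cancel_left₀ h0.ne']
  let A := hg.affineIsometryOfStrictConvexSpace
  have hA : ∀ x, A x = r⁻¹ • f x := fun x => rfl
  refine ⟨⟨r, A.linearIsometry.toLinearIsometryEquiv rfl, f 0, h0, h1⟩, rfl, ?_⟩
  funext x
  have h2 : A.linearIsometry x = A x - A 0 := by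
    have := A.map_vsub x 0
    simpa using this
  simp only [ContractingSimilarity.map, LinearIsometry.toLinearIsometryEquiv_apply, h2, hA]
  rw [← smul_sub, smul_inv_smul₀ h0.ne']
  simp

/-- A self-similar iterated function system in `ℝ^d`: finitely many contracting similarities
`S_1, …, S_m`. -/
structure SSIFS (m d : ℕ) where
  sim : Fin m → ContractingSimilarity d

namespace SSIFS

variable {m d : ℕ}

/-- `K` is the attractor: a nonempty compact set with `K = ⋃ i, S_i(K)`
(there is at most one such set). -/
def IsAttractor (F : SSIFS m d) (K : Set (Euc d)) : Prop :=
  K.Nonempty ∧ IsCompact K ∧ K = ⋃ i, (F.sim i).map '' K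

/-- `s` is the similarity dimension: the solution of `∑ i, r_i ^ s = 1`
(unique, by `IsSimilarityDimension.unique`). -/
def IsSimilarityDimension (F : SSIFS m d) (s : ℝ) : Prop :=
  ∑ i, (F.sim i).ratio ^ s = 1

theorem IsSimilarityDimension.unique {F : SSIFS m d} {s t : ℝ}
    (hs : F.IsSimilarityDimension s) (ht : F.IsSimilarityDimension t) : s = t := by
  have key : ∀ {a b : ℝ}, F.IsSimilarityDimension a → F.IsSimilarityDimension b → ¬ a < b := by
    intro a b ha hb hab
    unfold IsSimilarityDimension at ha hb
    have hne : (Finset.univ : Finset (Fin m)).Nonempty := by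
      rw [Finset.nonempty_iff_ne_empty]
      intro h
      simp [h] at ha
    have := Finset.sum_lt_sum_of_nonempty hne fun i _ =>
      Real.rpow_lt_rpow_of_exponent_gt (F.sim i).ratio_pos (F.sim i).ratio_lt_one hab
    linarith
  exact le_antisymm (not_lt.1 (key ht hs)) (not_lt.1 (key hs ht))

/-- The transformation group `𝒯`: the group generated by the orthogonal parts `T_i`. -/
def transformationGroup (F : SSIFS m d) : Subgroup (Euc d ≃ₗᵢ[ℝ] Euc d) :=
  Subgroup.closure (Set.range fun i => (F.sim i).orth)

end SSIFS

/-- A graph-directed iterated function system in `ℝ^d` on the vertex set `{1, …, q}`: a finite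
directed graph (parallel edges and loops allowed) in which every vertex has an outgoing edge,
with a contracting similarity of `ℝ^d` attached to every edge. -/
structure GDIFS (q d : ℕ) where
  Edge : Type
  [edgeFintype : Fintype Edge]
  src : Edge → Fin q
  tgt : Edge → Fin q
  exists_edge_from : ∀ i, ∃ e, src e = i
  sim : Edge → ContractingSimilarity d

namespace GDIFS

attribute [instance] GDIFS.edgeFintype

variable {q d : ℕ}

/-- The set `ℰ_{i,j}` of edges from `i` to `j`. -/
def edges (G : GDIFS q d) (i j : Fin q) : Finset G.Edge :=
  Finset.univ.filter fun e => G.src e = i ∧ G.tgt e = j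

/-- For all vertices `i`, `j` there is a directed path, with at least one edge, from `i` to `j`. -/
def IsStronglyConnected (G : GDIFS q d) : Prop :=
  ∀ i j, Relation.TransGen (fun a b => (G.edges a b).Nonempty) i j

/-- `(K_1, …, K_q)` is the attractor: a tuple of nonempty compact sets with
`K_i = ⋃ j, ⋃ e ∈ ℰ_{i,j}, S_e(K_j)` for all `i` (there is at most one such tuple). -/
def IsAttractor (G : GDIFS q d) (K : Fin q → Set (Euc d)) : Prop :=
  (∀ i, (K i).Nonempty ∧ IsCompact (K i)) ∧
    ∀ i, K i = ⋃ j, ⋃ e ∈ G.edges i j, (G.sim e).map '' K j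

/-- The matrix `A^{(s)}` with entries `∑ e ∈ ℰ_{i,j}, r_e ^ s`. -/
def matrixA (G : GDIFS q d) (s : ℝ) : Matrix (Fin q) (Fin q) ℝ :=
  fun i j => ∑ e ∈ G.edges i j, (G.sim e).ratio ^ s

/-- The spectral radius of `A^{(s)}`: the largest absolute value of its complex eigenvalues. -/
def rho (G : GDIFS q d) (s : ℝ) : ENNReal :=
  spectralRadius ℂ ((G.matrixA s).map Complex.ofReal)

/-- `s` is the similarity dimension: the unique real solution of `ρ(A^{(s)}) = 1`. -/
def IsSimilarityDimension (G : GDIFS q d) (s : ℝ) : Prop :=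
  G.rho s = 1 ∧ ∀ t, G.rho t = 1 → t = s

end GDIFS

end SelfSimilar

end

/-! Since `O i (S_k x) = r_k • (O i * T_k) x + O i v_k`, applying `L ∘ O i` to `K = ⋃ k, S_k(K)`
writes `L ∘ O i (K)` as a union of translates of `r_k`-scaled copies of `L ∘ (O i * T_k)(K)`. Each
`O i * T_k` is again some `O j`, so the rotation is absorbed into the vertex, and the graph is the
Cayley graph of the group. It is strongly connected because inverses in a finite group are positive
powers.

Every row of `A^{(t)}` has sum `∑ k, r_k ^ t`. For a nonnegative matrix this common row sum is the
spectral radius, so the two similarity dimensions agree.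

By subadditivity and scaling, the `s`-measure at each vertex is at most the average of its
neighbours' measures with weights `r_k ^ s`. These measures are finite, so the maximum principle
makes them equal; no separation condition is needed. -/

open Set Filter Topology MeasureTheory
open scoped ENNReal NNReal

/-! ### Spectral radius from row sums -/

namespace Matrix

/-- The spectral radius of a nonnegative matrix with constant row sums is the row sum. -/
theorem spectralRadius_map_ofReal_of_rowSum {ι : Type*} [Fintype ι] [DecidableEq ι] [Nonempty ι]
    (A : Matrix ι ι ℝ) (c : ℝ) (hA : ∀ i j, 0 ≤ A i j) (hc : ∀ i, ∑ j, A i j = c) :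
    spectralRadius ℂ (A.map Complex.ofReal) = ENNReal.ofReal c := by
  have hc0 : 0 ≤ c := by
    obtain ⟨i⟩ := ‹Nonempty ι›
    exact hc i ▸ Finset.sum_nonneg fun j _ => hA i j
  apply le_antisymm
  · refine iSup₂_le fun μ hμ => ?_
    rw [← Matrix.spectrum_toLin', ← Module.End.hasEigenvalue_iff_mem_spectrum] at hμ
    obtain ⟨v, hv⟩ := hμ.exists_hasEigenvector
    -- At a coordinate of maximal modulus, the eigenvalue equation bounds `‖μ‖` by the row sum.
    obtain ⟨i, -, hi⟩ := Finset.exists_max_image Finset.univ (fun i => ‖v i‖) Finset.univ_nonempty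
    have hvi : 0 < ‖v i‖ := by
      obtain ⟨j, hj⟩ := Function.ne_iff.1 hv.2
      exact (norm_pos_iff.2 hj).trans_le (hi j (Finset.mem_univ j))
    have h1 : ∑ j, (A i j : ℂ) * v j = μ * v i := by
      have := congrFun hv.apply_eq_smul i
      simpa [Matrix.mulVec, dotProduct] using this
    have h2 : ‖μ‖ * ‖v i‖ ≤ c * ‖v i‖ := by
      rw [← norm_mul, ← h1, ← hc i, Finset.sum_mul]
      refine (norm_sum_le _ _).trans (Finset.sum_le_sum fun j hj => ?_)
      rw [norm_mul, Complex.norm_real, Real.norm_of_nonneg (hA i j)]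
      exact mul_le_mul_of_nonneg_left (hi j hj) (hA i j)
    rw [← enorm_eq_nnnorm, ← ofReal_norm μ]
    exact ENNReal.ofReal_le_ofReal (le_of_mul_le_mul_right h2 hvi)
  · have hmem : (c : ℂ) ∈ spectrum ℂ (A.map Complex.ofReal) := by
      rw [← Matrix.spectrum_toLin', ← Module.End.hasEigenvalue_iff_mem_spectrum]
      refine Module.End.hasEigenvalue_of_hasEigenvector (x := fun _ => 1) ⟨?_, ?_⟩
      · rw [Module.End.mem_eigenspace_iff]
        ext i
        simp [Matrix.mulVec, dotProduct, ← hc i]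
      · exact fun h => one_ne_zero (congrFun h (Classical.arbitrary ι))
    have := le_iSup₂ (f := fun (k : ℂ) (_ : k ∈ spectrum ℂ (A.map Complex.ofReal)) =>
      (‖k‖₊ : ℝ≥0∞)) (c : ℂ) hmem
    refine le_trans (le_of_eq ?_) this
    rw [← enorm_eq_nnnorm, ← ofReal_norm, Complex.norm_real, Real.norm_of_nonneg hc0]

end Matrix

/-! ### Finite graphs and Cayley graphs -/

/-- Maximum principle: a real function on a finite set that is everywhere at most a weighted
average of its values at the out-neighbours is constant if the graph is strongly connected. -/
theorem eq_of_le_weighted_sum {V ι : Type*} [Finite V] [Fintype ι] (τ : V → ι → V)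
    (p : ι → ℝ) (hp : ∀ k, 0 < p k) (hp1 : ∑ k, p k = 1)
    (hconn : ∀ i j, Relation.ReflTransGen (fun a b => ∃ k, τ a k = b) i j)
    (a : V → ℝ) (ha : ∀ i, a i ≤ ∑ k, p k * a (τ i k)) (i j : V) : a i = a j := by
  have : Nonempty V := ⟨i⟩
  obtain ⟨i₀, h₀⟩ := Finite.exists_max a
  suffices h : ∀ j, a j = a i₀ by rw [h i, h j]
  intro j
  induction hconn i₀ j with
  | refl => rfl
  | @tail b c _ hbc ih =>
    obtain ⟨k, rfl⟩ := hbc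
    -- All weights are positive, so one out-neighbour below the maximum would push the average at
    -- `b` below `a b`.
    refine le_antisymm (h₀ _) (not_lt.1 fun hlt => ?_)
    have h1 : ∑ l, p l * a (τ b l) < ∑ l, p l * a i₀ :=
      Finset.sum_lt_sum (fun l _ => mul_le_mul_of_nonneg_left (h₀ _) (hp l).le)
        ⟨k, Finset.mem_univ k, mul_lt_mul_of_pos_left hlt (hp k)⟩
    rw [← Finset.sum_mul, hp1, one_mul] at h1
    exact absurd (ha b) (not_le.2 (ih ▸ h1))

/-- If a finite set is the range of `O` and equals the group generated by the `T k`, its Cayley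
graph with respect to the `T k` is strongly connected. -/
theorem reflTransGen_of_range_eq_closure {Γ V ι : Type*} [Group Γ] [Finite V] (T : ι → Γ)
    (O : V → Γ) (hO : Function.Injective O)
    (hT : range O = (Subgroup.closure (range T) : Set Γ)) (i j : V) :
    Relation.ReflTransGen (fun a b => ∃ k, O a * T k = O b) i j := by
  have : Finite (Subgroup.closure (range T)) := by
    have : (Subgroup.closure (range T) : Set Γ).Finite := hT ▸ finite_range O
    exact this.to_subtype
  have hmem : ∀ a, O a ∈ Subgroup.closure (range T) := fun a => by
    rw [← SetLike.mem_coe, ← hT]; exact mem_range_self a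
  -- Finite order makes the generated submonoid the whole group, so words without inverses, that is
  -- directed paths, suffice.
  have hfin : ∀ x ∈ range T, IsOfFinOrder x := fun x hx =>
    Submonoid.isOfFinOrder_coe.2 (isOfFinOrder_of_finite
      (⟨x, Subgroup.subset_closure hx⟩ : Subgroup.closure (range T)))
  have key : ∀ g ∈ Submonoid.closure (range T), ∀ a b, O b = O a * g →
      Relation.ReflTransGen (fun a b => ∃ k, O a * T k = O b) a b := by
    intro g hg
    induction hg using Submonoid.closure_induction_left with
    | one =>
      intro a b h
      rw [mul_one] at h
      rw [hO h]
    | mul_left x hx y hy ih =>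
      intro a b h
      obtain ⟨k, rfl⟩ := hx
      obtain ⟨c, hc⟩ : O a * T k ∈ range O := by
        rw [hT]
        exact mul_mem (hmem a) (Subgroup.subset_closure (mem_range_self k))
      refine (ih c b ?_).head ⟨k, hc.symm⟩
      rw [h, hc, mul_assoc]
  refine key ((O i)⁻¹ * O j) ?_ i j (by simp)
  rw [← Subgroup.closure_toSubmonoid_of_isOfFinOrder hfin, Subgroup.mem_toSubmonoid]
  exact mul_mem (inv_mem (hmem i)) (hmem j)

/-! ### Finiteness of Hausdorff measure -/

/-- A bounded set covered by its images under finitely many contractions with ratios `ρ k` has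
finite `s`-dimensional Hausdorff measure if `∑ k, ρ k ^ s = 1`. -/
theorem hausdorffMeasure_lt_top_of_subset_iUnion_image {X ι : Type*} [MetricSpace X]
    [MeasurableSpace X] [BorelSpace X] [Fintype ι] (f : ι → X → X) (ρ : ι → ℝ≥0)
    (hf : ∀ k, LipschitzWith (ρ k) (f k)) (hρ : ∀ k, ρ k < 1) {s : ℝ} (hs : 0 ≤ s)
    (hsum : ∑ k, ρ k ^ s = 1) {K : Set X} (hK : Bornology.IsBounded K)
    (hKf : K ⊆ ⋃ k, f k '' K) : μH[s] K < ∞ := by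
  -- Level-`n` pieces, indexed by words of length `n`.
  have hcover : ∀ n : ℕ, ∃ t : (Fin n → ι) → Set X, K ⊆ ⋃ w, t w ∧
      ∀ w, Metric.ediam (t w) ≤ (∏ i, ρ (w i) : ℝ≥0) * Metric.ediam K := by
    intro n
    induction n with
    | zero => exact ⟨fun _ => K, subset_iUnion (fun _ : Fin 0 → ι => K) default, fun w => by simp⟩
    | succ n ih =>
      obtain ⟨t, ht, hd⟩ := ih
      refine ⟨fun w => f (w 0) '' t (Fin.tail w), fun x hx => ?_, fun w => ?_⟩
      · obtain ⟨k, y, hy, rfl⟩ := mem_iUnion.1 (hKf hx)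
        obtain ⟨w, hw⟩ := mem_iUnion.1 (ht hy)
        exact mem_iUnion.2 ⟨Fin.cons k w, by simpa using mem_image_of_mem _ hw⟩
      · refine ((hf (w 0)).ediam_image_le _).trans ?_
        rw [Fin.prod_univ_succ, ENNReal.coe_mul, mul_assoc]
        gcongr
        exact hd (Fin.tail w)
  choose t ht hd using hcover
  set c : ℝ≥0 := Finset.univ.sup ρ
  have hc : c < 1 := (Finset.sup_lt_iff zero_lt_one).2 fun k _ => hρ k
  have hdiam : Metric.ediam K ≠ ∞ := hK.ediam_ne_top
  have hr : Tendsto (fun n : ℕ => (c : ℝ≥0∞) ^ n * Metric.ediam K) atTop (𝓝 0) := by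
    simpa using ENNReal.Tendsto.mul_const
      (ENNReal.tendsto_pow_atTop_nhds_zero_of_lt_one (ENNReal.coe_lt_one_iff.2 hc)) (Or.inr hdiam)
  refine (Measure.hausdorffMeasure_le_liminf_sum s K _ hr t ?_
    (Eventually.of_forall ht)).trans_lt ?_
  · refine Eventually.of_forall fun n w => (hd n w).trans ?_
    gcongr
    rw [← ENNReal.coe_pow, ENNReal.coe_le_coe]
    calc ∏ i, ρ (w i) ≤ ∏ _i : Fin n, c :=
          Finset.prod_le_prod' fun i _ => Finset.le_sup (f := ρ) (Finset.mem_univ (w i))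
      _ = c ^ n := by simp
  · have hbound : ∀ n, ∑ w, Metric.ediam (t n w) ^ s ≤ Metric.ediam K ^ s := by
      intro n
      calc ∑ w, Metric.ediam (t n w) ^ s
          ≤ ∑ w : Fin n → ι, ((∏ i, ρ (w i) ^ s : ℝ≥0) : ℝ≥0∞) * Metric.ediam K ^ s := by
            refine Finset.sum_le_sum fun w _ => ?_
            rw [NNReal.finsetProd_rpow, ENNReal.coe_rpow_of_nonneg _ hs,
              ← ENNReal.mul_rpow_of_nonneg _ _ hs]
            exact ENNReal.rpow_le_rpow (hd n w) hs
        _ = Metric.ediam K ^ s := by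
            -- Summing the products over all words gives `(∑ k, ρ k ^ s) ^ n = 1`.
            rw [← Finset.sum_mul, ← ENNReal.ofNNReal_finsetSum,
              ← Fintype.sum_pow (fun k => ρ k ^ s), hsum]
            simp
    refine (liminf_le_of_frequently_le' (Eventually.of_forall hbound).frequently).trans_lt ?_
    exact ENNReal.rpow_lt_top_of_nonneg hs hdiam

/-! ### The projected graph-directed system -/

namespace SelfSimilar

theorem GDIFS.mem_edges {q d : ℕ} (G : GDIFS q d) {i j : Fin q} (e : G.Edge) :
    e ∈ G.edges i j ↔ G.src e = i ∧ G.tgt e = j := by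
  simp [GDIFS.edges]

namespace SSIFS

variable {m d d₂ q : ℕ} {F : SSIFS m d} {K : Set (Euc d)} {s : ℝ}

theorem IsAttractor.pos (hK : F.IsAttractor K) : 0 < m := by
  obtain ⟨x, hx⟩ := hK.1
  rw [hK.2.2] at hx
  obtain ⟨k, -⟩ := mem_iUnion.1 hx
  exact k.pos

theorem IsSimilarityDimension.nonneg (hs : F.IsSimilarityDimension s) (hm : 0 < m) : 0 ≤ s := by
  by_contra! h
  have h1 : (F.sim ⟨0, hm⟩).ratio ^ s ≤ ∑ i, (F.sim i).ratio ^ s :=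
    Finset.single_le_sum (f := fun i => (F.sim i).ratio ^ s)
      (fun i _ => Real.rpow_nonneg (F.sim i).ratio_pos.le s) (Finset.mem_univ _)
  have h2 := Real.one_lt_rpow_of_pos_of_lt_one_of_neg (F.sim ⟨0, hm⟩).ratio_pos
    (F.sim ⟨0, hm⟩).ratio_lt_one h
  rw [hs] at h1
  exact absurd h1 (not_le.2 h2)

theorem IsAttractor.hausdorffMeasure_lt_top (hK : F.IsAttractor K)
    (hs : F.IsSimilarityDimension s) : μH[s] K < ∞ := by
  refine hausdorffMeasure_lt_top_of_subset_iUnion_image (fun k => (F.sim k).map)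
    (fun k => ⟨(F.sim k).ratio, (F.sim k).ratio_pos.le⟩)
    (fun k => LipschitzWith.of_dist_le_mul fun x y => ((F.sim k).dist_map x y).le)
    (fun k => (F.sim k).ratio_lt_one) (hs.nonneg hK.pos) ?_ hK.2.1.isBounded hK.2.2.subset
  rw [← NNReal.coe_inj]
  push_cast
  exact hs

/-- Linear images of rotated copies of an attractor decompose into translated and scaled linear
images of further rotated copies. -/
theorem IsAttractor.image_linear (hK : F.IsAttractor K) (L : Euc d →ₗ[ℝ] Euc d₂)
    (g : Euc d ≃ₗᵢ[ℝ] Euc d) :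
    (fun x => L (g x)) '' K = ⋃ k, (fun y => (F.sim k).ratio • y + L (g (F.sim k).trans)) ''
      ((fun x => L ((g * (F.sim k).orth) x)) '' K) := by
  conv_lhs => rw [hK.2.2]
  simp only [image_iUnion, image_image]
  simp [ContractingSimilarity.map]

/-- The graph-directed system induced on `(L ∘ O i (K))_i`: the edges are the pairs `(i, k)`,
where `(i, k)` leads from `i` to `τ i k` and carries `y ↦ r_k y + L (O i v_k)`. -/
noncomputable def projectedGDIFS (F : SSIFS m d) (hm : 0 < m) (L : Euc d →ₗ[ℝ] Euc d₂)
    (O : Fin q → (Euc d ≃ₗᵢ[ℝ] Euc d)) (τ : Fin q → Fin m → Fin q) : GDIFS q d₂ where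
  Edge := Fin q × Fin m
  src e := e.1
  tgt e := τ e.1 e.2
  exists_edge_from i := ⟨(i, ⟨0, hm⟩), rfl⟩
  sim e :=
    { ratio := (F.sim e.2).ratio
      orth := LinearIsometryEquiv.refl ℝ _
      trans := L (O e.1 (F.sim e.2).trans)
      ratio_pos := (F.sim e.2).ratio_pos
      ratio_lt_one := (F.sim e.2).ratio_lt_one }

section projectedGDIFS

variable {hm : 0 < m} {L : Euc d →ₗ[ℝ] Euc d₂} {O : Fin q → (Euc d ≃ₗᵢ[ℝ] Euc d)}
  {τ : Fin q → Fin m → Fin q}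

theorem mem_edges_projectedGDIFS {i j : Fin q} {e : Fin q × Fin m} :
    e ∈ (F.projectedGDIFS hm L O τ).edges i j ↔ e.1 = i ∧ τ e.1 e.2 = j :=
  GDIFS.mem_edges (F.projectedGDIFS hm L O τ) e

theorem map_projectedGDIFS (e : Fin q × Fin m) :
    ((F.projectedGDIFS hm L O τ).sim e).map =
      fun y => (F.sim e.2).ratio • y + L (O e.1 (F.sim e.2).trans) := rfl

theorem projectedGDIFS_isAttractor (hK : F.IsAttractor K)
    (hτ : ∀ i k, O (τ i k) = O i * (F.sim k).orth) :
    (F.projectedGDIFS hm L O τ).IsAttractor (fun i => (fun x => L (O i x)) '' K) := by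
  refine ⟨fun i => ⟨hK.1.image _, hK.2.1.image ?_⟩, fun i => ?_⟩
  · exact L.continuous_of_finiteDimensional.comp (O i).continuous
  · refine (hK.image_linear L (O i)).trans ?_
    apply Subset.antisymm
    · refine iUnion_subset fun k => ?_
      rw [← hτ i k]
      exact subset_iUnion_of_subset (τ i k) (subset_iUnion₂_of_subset (i, k)
        (mem_edges_projectedGDIFS.2 ⟨rfl, rfl⟩) Subset.rfl)
    · refine iUnion_subset fun j => iUnion₂_subset fun e he => ?_
      obtain ⟨rfl, rfl⟩ := mem_edges_projectedGDIFS.1 he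
      refine subset_iUnion_of_subset e.2 ?_
      rw [← hτ e.1 e.2]
      exact Subset.rfl

theorem projectedGDIFS_isStronglyConnected
    (h : ∀ i j, Relation.ReflTransGen (fun a b => ∃ k, τ a k = b) i j) :
    (F.projectedGDIFS hm L O τ).IsStronglyConnected := by
  have hmono : ∀ a b, (∃ k, τ a k = b) → ((F.projectedGDIFS hm L O τ).edges a b).Nonempty :=
    fun a b ⟨k, hk⟩ => ⟨(a, k), mem_edges_projectedGDIFS.2 ⟨rfl, hk⟩⟩
  -- An initial edge makes the path nonempty even when `i = j`.
  exact fun i j => Relation.TransGen.head' (hmono i _ ⟨⟨0, hm⟩, rfl⟩)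
    (Relation.ReflTransGen.mono hmono _ _ (h (τ i ⟨0, hm⟩) j))

/-- The edges leaving `i` are the pairs `(i, k)`; sorting them by target only regroups the sum over
`k`, so the row sum does not depend on `i`. -/
theorem rho_projectedGDIFS [NeZero q] (t : ℝ) :
    (F.projectedGDIFS hm L O τ).rho t = ENNReal.ofReal (∑ k, (F.sim k).ratio ^ t) := by
  refine Matrix.spectralRadius_map_ofReal_of_rowSum _ _ (fun i j => ?_) fun i => ?_
  · exact Finset.sum_nonneg fun e _ => Real.rpow_nonneg (GDIFS.sim _ e).ratio_pos.le t
  · have h : ∀ j, (F.projectedGDIFS hm L O τ).matrixA t i j =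
        ∑ k, if τ i k = j then (F.sim k).ratio ^ t else 0 := by
      intro j
      rw [← Finset.sum_filter]
      refine Finset.sum_bij' (fun e _ => e.2) (fun k _ => (i, k)) ?_ ?_ ?_ ?_ ?_
      · intro e he
        obtain ⟨rfl, h⟩ := mem_edges_projectedGDIFS.1 he
        simpa using h
      · intro k hk
        exact mem_edges_projectedGDIFS.2 ⟨rfl, by simpa using hk⟩
      · intro e he
        obtain ⟨rfl, -⟩ := mem_edges_projectedGDIFS.1 he
        rfl
      · exact fun k hk => rfl
      · exact fun e he => rfl
    simp only [h]
    rw [Finset.sum_comm]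
    simp

theorem projectedGDIFS_isSimilarityDimension [NeZero q] (hs : F.IsSimilarityDimension s) :
    (F.projectedGDIFS hm L O τ).IsSimilarityDimension s := by
  refine ⟨?_, fun t ht => ?_⟩
  · rw [rho_projectedGDIFS, hs, ENNReal.ofReal_one]
  · rw [rho_projectedGDIFS, ENNReal.ofReal_eq_one] at ht
    exact IsSimilarityDimension.unique ht hs

end projectedGDIFS

/-- The `s`-dimensional Hausdorff measure is the same for all the sets `L ∘ O i (K)`. -/
theorem IsAttractor.hausdorffMeasure_image_linear_eq (hK : F.IsAttractor K)
    (hs : F.IsSimilarityDimension s) (L : Euc d →ₗ[ℝ] Euc d₂) (O : Fin q → (Euc d ≃ₗᵢ[ℝ] Euc d))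
    (τ : Fin q → Fin m → Fin q) (hτ : ∀ i k, O (τ i k) = O i * (F.sim k).orth)
    (h : ∀ i j, Relation.ReflTransGen (fun a b => ∃ k, τ a k = b) i j) (i j : Fin q) :
    μH[s] ((fun x => L (O i x)) '' K) = μH[s] ((fun x => L (O j x)) '' K) := by
  have hs0 : 0 ≤ s := hs.nonneg hK.pos
  have hfin : ∀ i, μH[s] ((fun x => L (O i x)) '' K) ≠ ∞ := by
    intro i
    have hL : LipschitzWith (‖L.toContinuousLinearMap‖₊ * 1) (fun x => L (O i x)) :=
      L.toContinuousLinearMap.lipschitz.comp (O i).isometry.lipschitz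
    refine ((hL.hausdorffMeasure_image_le hs0 K).trans_lt ?_).ne
    exact ENNReal.mul_lt_top (ENNReal.rpow_lt_top_of_nonneg hs0 ENNReal.coe_ne_top)
      (hK.hausdorffMeasure_lt_top hs)
  rw [← ENNReal.toReal_eq_toReal_iff' (hfin i) (hfin j)]
  refine eq_of_le_weighted_sum τ (fun k => (F.sim k).ratio ^ s)
    (fun k => Real.rpow_pos_of_pos (F.sim k).ratio_pos s) hs h
    (fun i => (μH[s] ((fun x => L (O i x)) '' K)).toReal) (fun i => ?_) i j
  have hle : μH[s] ((fun x => L (O i x)) '' K) ≤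
      ∑ k, ENNReal.ofReal ((F.sim k).ratio ^ s) * μH[s] ((fun x => L (O (τ i k) x)) '' K) := by
    rw [hK.image_linear L (O i)]
    refine (measure_iUnion_fintype_le _ _).trans (Finset.sum_le_sum fun k _ => ?_)
    rw [← hτ i k]
    have hlip : LipschitzWith ⟨(F.sim k).ratio, (F.sim k).ratio_pos.le⟩
        (fun y => (F.sim k).ratio • y + L (O i (F.sim k).trans)) := by
      refine LipschitzWith.of_dist_le_mul fun x y => le_of_eq ?_
      rw [dist_add_right, dist_smul₀, Real.norm_of_nonneg (F.sim k).ratio_pos.le]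
      rfl
    refine (hlip.hausdorffMeasure_image_le hs0 _).trans (le_of_eq ?_)
    rw [← ENNReal.ofReal_rpow_of_nonneg (F.sim k).ratio_pos.le hs0, ENNReal.ofReal,
      Real.toNNReal_of_nonneg (F.sim k).ratio_pos.le]
    rfl
  have hterm : ∀ k, ENNReal.ofReal ((F.sim k).ratio ^ s) *
      μH[s] ((fun x => L (O (τ i k) x)) '' K) ≠ ∞ := fun k =>
    ENNReal.mul_ne_top ENNReal.ofReal_ne_top (hfin _)
  refine (ENNReal.toReal_mono (ENNReal.sum_ne_top.2 fun k _ => hterm k) hle).trans_eq ?_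
  rw [ENNReal.toReal_sum fun k _ => hterm k]
  refine Finset.sum_congr rfl fun k _ => ?_
  rw [ENNReal.toReal_mul, ENNReal.toReal_ofReal (Real.rpow_nonneg (F.sim k).ratio_pos.le s)]

end SSIFS

end SelfSimilar

theorem mainTheorem4 {m d d₂ q : ℕ} (F : SelfSimilar.SSIFS m d) (K : Set (SelfSimilar.Euc d))
    (hK : F.IsAttractor K) (hK2 : K.Nontrivial)
    (s : ℝ) (hs : F.IsSimilarityDimension s)
    (L : SelfSimilar.Euc d →ₗ[ℝ] SelfSimilar.Euc d₂)
    (O : Fin q → (SelfSimilar.Euc d ≃ₗᵢ[ℝ] SelfSimilar.Euc d))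
    (hO : Function.Injective O)
    (hT : Set.range O = (F.transformationGroup : Set (SelfSimilar.Euc d ≃ₗᵢ[ℝ] SelfSimilar.Euc d))) :
    (∃ G : SelfSimilar.GDIFS q d₂,
      G.IsStronglyConnected ∧
      G.IsAttractor (fun i => (fun x => L (O i x)) '' K) ∧
      (∀ e, (G.sim e).orth = LinearIsometryEquiv.refl ℝ (SelfSimilar.Euc d₂)) ∧
      G.IsSimilarityDimension s) ∧
    ∀ i j, MeasureTheory.Measure.hausdorffMeasure s ((fun x => L (O i x)) '' K) =
      MeasureTheory.Measure.hausdorffMeasure s ((fun x => L (O j x)) '' K) := by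
  have hm := hK.pos
  have hmem : ∀ i k, ∃ j, O j = O i * (F.sim k).orth := by
    intro i k
    have hi : O i ∈ F.transformationGroup := by
      rw [← SetLike.mem_coe, ← hT]
      exact mem_range_self i
    have : O i * (F.sim k).orth ∈ range O := by
      rw [hT]
      exact mul_mem hi (Subgroup.subset_closure (mem_range_self k))
    exact this
  choose τ hτ using hmem
  have hconn : ∀ i j, Relation.ReflTransGen (fun a b => ∃ k, τ a k = b) i j := fun i j =>
    Relation.ReflTransGen.mono (fun a b ⟨k, hk⟩ => ⟨k, hO ((hτ a k).trans hk)⟩) _ _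
      (reflTransGen_of_range_eq_closure (fun k => (F.sim k).orth) O hO hT i j)
  -- The group contains the identity, so there is a vertex; the spectral radius of an empty matrix
  -- would be `0`.
  obtain ⟨i₀, -⟩ : (1 : SelfSimilar.Euc d ≃ₗᵢ[ℝ] SelfSimilar.Euc d) ∈ range O := by
    rw [hT]
    exact one_mem F.transformationGroup
  have : NeZero q := ⟨i₀.pos.ne'⟩
  exact ⟨⟨F.projectedGDIFS hm L O τ,
    SelfSimilar.SSIFS.projectedGDIFS_isStronglyConnected hconn,
    SelfSimilar.SSIFS.projectedGDIFS_isAttractor hK hτ, fun _ => rfl,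
    SelfSimilar.SSIFS.projectedGDIFS_isSimilarityDimension hs⟩,
    hK.hausdorffMeasure_image_linear_eq hs L O τ hτ hconn⟩
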